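/- Notation. For positive integers $n,t$, a \emph{sparse embedding matrix} (CountSketch) with $t$ rows is the random $t\times n$ matrix $\Phi D$, where $\Phi\in\{0,1\}^{t\times n}$ has $\Phi_{h(i),i}=1$ and all other entries $0$, the values $h(1),\dots,h(n)$ are uniform on $\{1,\dots,t\}$, $D$ is diagonal with diagonal entries uniform on $\{+1,-1\}$, and all these values and signs are independent. For $A\in\mathbb R^{n\times d}$ let $C(A)$ be its column space and $\mathrm{nnz}(A)$ its number of non-zero entries. A matrix $S$ is an $\varepsilon$-subspace embedding for $A$ if $(1-\varepsilon)\|y\|_2\le\|Sy\|_2\le(1+\varepsilon)\|y\|_2$ for all $y\in C(A)$. If $A$ has rank $r$ and $U\in\mathbb R^{n\times r}$ has columns that form an orthonormal basis of $C(A)$, let $u_1\ge u_2\ge\dots\ge u_n$ be the squared Euclidean norms of the rows of $U$ (the leverage scores) in non-increasing order, and for $T>0$ let $s=\min\{i\mid u_i\le T\}$ (with $s=n+1$ if there is no such $i$). Theorem. Let $r\ge 1$ be an integer and $0<\varepsilon<1$, with $r/\varepsilon\ge 2$. (1) There is $t=O((r/\varepsilon)^4\log^2(r/\varepsilon))$,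 depending only on $r$ and $\varepsilon$, such that for every real matrix $A$ of rank $r$ (of any size $n\times d$), $\Phi D$ with $t$ rows is an $\varepsilon$-subspace embedding for $A$ with probability at least $9/10$. (2) For every number $t\ge1$ of rows and every $A\in\mathbb R^{n\times d}$ with $n\ge 1$ and $\mathrm{nnz}(A)\ge n$, $\Phi D$ can be drawn and $\Phi DA$ computed in $O(\mathrm{nnz}(A))$ time: a single program of a random access machine (memory initially zero, exact real arithmetic, words just long enough to hold $n$, $\mathrm{nnz}(A)$ and $td$, unit-cost instructions, including draws of a uniform element of $\{1,\dots,t\}$ and of a uniform sign) does this, given $A$ as a list of its non-zero entries in any order. (3) There is an absolute constant $c>0$ such that for every $T$ with $0<T\le c\,\varepsilon^2/(r\log(r/\varepsilon))$ (in particular for $T$ equal to this bound), for every real matrix $A$ of rank $r$ and the $s$ that belongs to $A$ and $T$, every $t\ge\max\{s^2/30,\ r/T\}$ suffices: $\Phi D$ with $t$ rows is an $\varepsilon$-subspace embedding for $A$ with probability at least $9/10$. -/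

import Mathlib

open scoped Matrix

noncomputable section

/-! Sparse embedding matrices -/

/-- The value `±1` coded by a fair bit. -/
def signVal (b : Bool) : ℝ := if b then 1 else -1

/-- The `t × n` binary matrix `Φ` with `Φ (h i) i = 1` and all remaining entries `0`. -/
def hashMatrix {n t : ℕ} (h : Fin n → Fin t) : Matrix (Fin t) (Fin n) ℝ :=
  Matrix.of fun a i => if h i = a then 1 else 0

/-- The `n × n` diagonal matrix `D` of signs. -/
def signMatrix {n : ℕ} (b : Fin n → Bool) : Matrix (Fin n) (Fin n) ℝ :=
  Matrix.diagonal fun i => signVal (b i)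

/-- The sparse embedding matrix `Φ D` given by the hash function `h` and the signs `b`. -/
def sparseEmbedding {n t : ℕ} (h : Fin n → Fin t) (b : Fin n → Bool) :
    Matrix (Fin t) (Fin n) ℝ :=
  hashMatrix h * signMatrix b

/-- The uniform distribution of a pair `(h, b)`: all the values `h i` and `b i` are independent,
`h i` is uniform on the `t` buckets and `b i` is a fair bit. -/
def sketchMeasure (n t : ℕ) : MeasureTheory.Measure ((Fin n → Fin t) × (Fin n → Bool)) :=
  ProbabilityTheory.uniformOn Set.univ

/-- The Euclidean norm of a vector with `n` real coordinates. -/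
def l2norm {n : ℕ} (y : Fin n → ℝ) : ℝ := ‖WithLp.toLp 2 y‖

/-- The column space of `A`. -/
def colSpace {n d : ℕ} (A : Matrix (Fin n) (Fin d) ℝ) : Submodule ℝ (Fin n → ℝ) :=
  LinearMap.range A.mulVecLin

/-- `S` is a subspace embedding matrix for `A` with distortion `ε`:
`‖S y‖ = (1 ± ε) ‖y‖` for all `y` in the column space of `A`. -/
def IsSubspaceEmbedding {n d t : ℕ} (ε : ℝ) (S : Matrix (Fin t) (Fin n) ℝ)
    (A : Matrix (Fin n) (Fin d) ℝ) : Prop :=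
  ∀ y ∈ colSpace A,
    (1 - ε) * l2norm y ≤ l2norm (S *ᵥ y) ∧ l2norm (S *ᵥ y) ≤ (1 + ε) * l2norm y

/-- The probability that a random sparse embedding matrix with `t` rows is a subspace embedding
matrix for `A` with distortion `ε`. -/
def embeddingProb {n d : ℕ} (t : ℕ) (ε : ℝ) (A : Matrix (Fin n) (Fin d) ℝ) : ℝ :=
  (sketchMeasure n t).real {ω | IsSubspaceEmbedding ε (sparseEmbedding ω.1 ω.2) A}

/-! Leverage scores -/

/-- The columns of `U` are an orthonormal basis of the column space of `A`. -/
def IsOrthonormalBasisOf {n d r : ℕ} (U : Matrix (Fin n) (Fin r) ℝ)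
    (A : Matrix (Fin n) (Fin d) ℝ) : Prop :=
  Uᵀ * U = 1 ∧ colSpace U = colSpace A

/-- The squared norms of the rows of `U`. -/
def leverage {n r : ℕ} (U : Matrix (Fin n) (Fin r) ℝ) (i : Fin n) : ℝ := ∑ k, U i k ^ 2

/-- The squared norms of the rows of `U`, rearranged in non-increasing order. -/
def sortedLeverage {n r : ℕ} (U : Matrix (Fin n) (Fin r) ℝ) : Fin n → ℝ :=
  leverage U ∘ Tuple.sort fun i => -leverage U i

/-- The least `i ≥ 1` such that the `i`-th largest leverage score (counted from `1`) is at most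
`T`; it is `n + 1` if all `n` leverage scores exceed `T`. -/
def thresholdIndex {n r : ℕ} (U : Matrix (Fin n) (Fin r) ℝ) (T : ℝ) : ℕ :=
  sInf {i : ℕ | 1 ≤ i ∧ ∀ j : Fin n, (j : ℕ) + 1 = i → sortedLeverage U j ≤ T}

/-! A random access machine with finitely many word registers, real registers, word arrays and
real arrays in each program. Words are the natural numbers below a bound `W`, with arithmetic
modulo `W`; real registers hold exact real numbers. Each instruction takes one step. -/

/-- Instructions; registers and arrays are numbered, and jump targets are program positions. -/
inductive Instr where
  | wconst (dst k : ℕ)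
  | wadd (dst a b : ℕ)
  | wmul (dst a b : ℕ)
  | wload (dst arr addr : ℕ)
  | wstore (arr addr src : ℕ)
  | radd (dst a b : ℕ)
  | rmul (dst a b : ℕ)
  | rload (dst arr addr : ℕ)
  | rstore (arr addr src : ℕ)
  | drawIndex (dst : ℕ)
  | drawSign (dst : ℕ)
  | jump (target : ℕ)
  | jumpLt (a b target : ℕ)

/-- A configuration: program counter, word and real registers, word and real arrays, and the
numbers of random indices and random signs drawn so far. -/
structure Config where
  pc : ℕ
  wreg : ℕ → ℕ
  rreg : ℕ → ℝ
  wmem : ℕ → ℕ → ℕ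
  rmem : ℕ → ℕ → ℝ
  indexPos : ℕ
  signPos : ℕ

/-- Write cell `addr` of array `arr`. -/
def storeCell {α : Type} (mem : ℕ → ℕ → α) (arr addr : ℕ) (v : α) : ℕ → ℕ → α :=
  Function.update mem arr (Function.update (mem arr) addr v)

/-- The effect of one instruction; `hs` is the source of random indices below `t` and `bs` the
source of random bits, from which successive draws take successive elements. -/
def Instr.exec {t : ℕ} (W : ℕ) (hs : ℕ → Fin t) (bs : ℕ → Bool) (c : Config) : Instr → Config
  | .wconst dst k =>
      { c with pc := c.pc + 1, wreg := Function.update c.wreg dst (k % W) }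
  | .wadd dst a b =>
      { c with pc := c.pc + 1
               wreg := Function.update c.wreg dst ((c.wreg a + c.wreg b) % W) }
  | .wmul dst a b =>
      { c with pc := c.pc + 1
               wreg := Function.update c.wreg dst ((c.wreg a * c.wreg b) % W) }
  | .wload dst arr addr =>
      { c with pc := c.pc + 1
               wreg := Function.update c.wreg dst (c.wmem arr (c.wreg addr)) }
  | .wstore arr addr src =>
      { c with pc := c.pc + 1
               wmem := storeCell c.wmem arr (c.wreg addr) (c.wreg src) }
  | .radd dst a b =>
      { c with pc := c.pc + 1
               rreg := Function.update c.rreg dst (c.rreg a + c.rreg b) }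
  | .rmul dst a b =>
      { c with pc := c.pc + 1
               rreg := Function.update c.rreg dst (c.rreg a * c.rreg b) }
  | .rload dst arr addr =>
      { c with pc := c.pc + 1
               rreg := Function.update c.rreg dst (c.rmem arr (c.wreg addr)) }
  | .rstore arr addr src =>
      { c with pc := c.pc + 1
               rmem := storeCell c.rmem arr (c.wreg addr) (c.rreg src) }
  | .drawIndex dst =>
      { c with pc := c.pc + 1
               wreg := Function.update c.wreg dst (hs c.indexPos : ℕ)
               indexPos := c.indexPos + 1 }
  | .drawSign dst =>
      { c with pc := c.pc + 1
               rreg := Function.update c.rreg dst (signVal (bs c.signPos))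
               signPos := c.signPos + 1 }
  | .jump target => { c with pc := target }
  | .jumpLt a b target =>
      { c with pc := if c.wreg a < c.wreg b then target else c.pc + 1 }

/-- One step of a program. The machine has halted when the program counter is outside the
program; it then stays where it is. -/
def machineStep {t : ℕ} (prog : List Instr) (W : ℕ) (hs : ℕ → Fin t) (bs : ℕ → Bool)
    (c : Config) : Config :=
  match prog[c.pc]? with
  | none => c
  | some i => i.exec W hs bs c

/-- The configuration after `k` steps. -/
def machineRun {t : ℕ} (prog : List Instr) (W : ℕ) (hs : ℕ → Fin t) (bs : ℕ → Bool)
    (k : ℕ) (c : Config) : Config :=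
  (machineStep prog W hs bs)^[k] c

/-- The machine has halted. -/
def Config.Halted (prog : List Instr) (c : Config) : Prop := prog.length ≤ c.pc

/-- The number of non-zero entries. -/
def nnz {n d : ℕ} (A : Matrix (Fin n) (Fin d) ℝ) : ℕ :=
  Nat.card {p : Fin n × Fin d // A p.1 p.2 ≠ 0}

/-- A listing of the non-zero entries of `A`, in any order. -/
abbrev EntryList {n d : ℕ} (A : Matrix (Fin n) (Fin d) ℝ) : Type :=
  Fin (nnz A) ≃ {p : Fin n × Fin d // A p.1 p.2 ≠ 0}

/-- The initial configuration on input `A` and `t`: word registers `0, 1, 2, 3` hold `n`, `d`,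
`t` and `nnz A`; word arrays `0` and `1` and real array `0` hold the row indices, the column
indices and the values of the listed non-zero entries of `A`; everything else is `0`. -/
def initialConfig {n d : ℕ} (A : Matrix (Fin n) (Fin d) ℝ) (e : EntryList A) (t : ℕ) : Config where
  pc := 0
  wreg := fun j => if j = 0 then n else if j = 1 then d else if j = 2 then t
    else if j = 3 then nnz A else 0
  rreg := fun _ => 0
  wmem := fun arr k => if hk : k < nnz A then
      (if arr = 0 then ((e ⟨k, hk⟩).1.1 : ℕ) else if arr = 1 then ((e ⟨k, hk⟩).1.2 : ℕ) else 0)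
    else 0
  rmem := fun arr k => if hk : k < nnz A then
      (if arr = 0 then A (e ⟨k, hk⟩).1.1 (e ⟨k, hk⟩).1.2 else 0)
    else 0
  indexPos := 0
  signPos := 0

/-- Real array `1` holds the `t × d` matrix `M`, row after row. -/
def Config.Outputs {t d : ℕ} (c : Config) (M : Matrix (Fin t) (Fin d) ℝ) : Prop :=
  ∀ (a : Fin t) (b : Fin d), c.rmem 1 ((a : ℕ) * d + b) = M a b

/-- Within `N` steps the program draws a sparse embedding matrix with `t` rows and multiplies it
with `A`: for every listing of the entries of `A`, every word range that can address the data,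
and every outcome of the random sources, it halts within `N` steps with output `Φ D A`, where
`Φ D` is given by the first `n` elements of the two random sources. -/
def SketchesWithin (prog : List Instr) {n d : ℕ} (A : Matrix (Fin n) (Fin d) ℝ) (t N : ℕ) : Prop :=
  ∀ (e : EntryList A) (W : ℕ), n < W → nnz A < W → t * d < W →
    ∀ (hs : ℕ → Fin t) (bs : ℕ → Bool), ∃ k ≤ N,
      (machineRun prog W hs bs k (initialConfig A e t)).Halted prog ∧
      (machineRun prog W hs bs k (initialConfig A e t)).Outputs
        (sparseEmbedding (fun i : Fin n => hs i) (fun i : Fin n => bs i) * A)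

end

/-!
Let the columns of `U` be an orthonormal basis of the column space of `A`, and let `S = Φ D`. Both
bounds on the number of rows follow from a second moment estimate for the matrix
`G = Uᵀ Sᵀ S U - 1`, which does not involve the leverage scores. As the signs square to `1` and
`Uᵀ U = 1`, the diagonal terms cancel the identity, and
`G k l = ∑ U i k * U j l * σ i * σ j`, over the pairs `i ≠ j` with `h i = h j`.
For fixed `h` this is a quadratic form in independent signs with zero diagonal, so its second moment
is at most twice the sum of the squared coefficients (`sum_sq_sign_chaos_le`). Two distinct indices
collide under `h` with probability `1 / t` (`mul_sum_collision`), whence `𝔼 (G k l)² ≤ 2 / t` and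
`𝔼 ‖G‖_F² ≤ 2 r² / t`. If `‖G‖_F ≤ ε` then `S` changes the squared norm of each vector of the column
space by a factor in `[1 - ε, 1 + ε]`, which is more than enough for distortion `ε`. By Markov's
inequality `20 (r / ε)²` rows suffice for probability `9 / 10` (`embeddingProb_ge`).

This is at most `21 (r / ε)⁴ log² (r / ε)` even after rounding up, as `r / ε ≥ 2` and hence
`log (r / ε) ≥ 1 / 2`. For the threshold condition, `t ≥ r / T` and `T ≤ ε² / (40 r log (r / ε))` already force
`t ≥ 20 (r / ε)²`.

For the running time, an explicit program of twenty instructions first draws the `n` hash values and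
signs, six steps each, and then scans the entries once, adding `σ i * A i j` to cell
`(h i, j)` of the output, thirteen steps each. Its correctness is an invariant for each of the two
loops (`DrawInvariant.step`, `AccumulateInvariant.step`).
-/

/-! ### Moments of random signs and collisions of random hash values -/

theorem signVal_mul_self (b : Bool) : signVal b * signVal b = 1 := by
  cases b <;> simp [signVal]

theorem signVal_not (b : Bool) : signVal (!b) = -signVal b := by
  cases b <;> simp [signVal]

/-- A function of the signs that is odd in one of them has mean zero. -/
theorem sum_eq_zero_of_flip {n : ℕ} (p : Fin n) (g : (Fin n → Bool) → ℝ)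
    (hg : ∀ b, g (Function.update b p (!b p)) = -g b) : ∑ b, g b = 0 := by
  have hinv : Function.Involutive fun b : Fin n → Bool => Function.update b p (!b p) := by
    intro b
    simp
  have h := Equiv.sum_comp hinv.toPerm g
  simp only [Function.Involutive.coe_toPerm, hg, Finset.sum_neg_distrib] at h
  linarith

/-- Fourth moments of independent signs: the product of two pairs of distinct signs has mean `1` if
the pairs agree up to order and `0` otherwise, since then some index occurs exactly once. -/
theorem sum_signVal_pairs {n : ℕ} {p q : Fin n × Fin n} (hp : p.1 ≠ p.2) (hq : q.1 ≠ q.2) :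
    ∑ b : Fin n → Bool, (signVal (b p.1) * signVal (b p.2)) * (signVal (b q.1) * signVal (b q.2)) =
      2 ^ n * ((if q = p then 1 else 0) + if q = p.swap then 1 else 0) := by
  obtain ⟨i, j⟩ := p
  obtain ⟨k, l⟩ := q
  simp only [Prod.swap_prod_mk, Prod.mk.injEq] at *
  have hone : ∀ b : Fin n → Bool,
      (signVal (b i) * signVal (b j)) * (signVal (b i) * signVal (b j)) = 1 := fun b => by
    rw [mul_mul_mul_comm, signVal_mul_self, signVal_mul_self, one_mul]
  by_cases hki : k = i
  · subst hki
    by_cases hlj : l = j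
    · subst hlj
      simp [hone, hp]
    · rw [sum_eq_zero_of_flip j]
      · simp [hlj, hp]
      · intro b
        simp [hlj, hp, signVal_not]
  · by_cases hli : l = i
    · subst hli
      by_cases hkj : k = j
      · subst hkj
        have hone' : ∀ b : Fin n → Bool,
            (signVal (b l) * signVal (b k)) * (signVal (b k) * signVal (b l)) = 1 := fun b => by
          rw [mul_comm (signVal (b k)), hone]
        simp [hone', hq]
      · rw [sum_eq_zero_of_flip j]
        · simp [hkj, hki]
        · intro b
          simp [hkj, hp, signVal_not]
    · rw [sum_eq_zero_of_flip i]
      · simp [hki, hli]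
      · intro b
        simp [hki, hli, hp.symm, signVal_not]

/-- The second moment of an off-diagonal quadratic form in independent signs, scaled by the number
`2 ^ n` of sign patterns. -/
theorem sum_sq_sign_chaos {n : ℕ} (M : Fin n × Fin n → ℝ) (hM : ∀ i, M (i, i) = 0) :
    ∑ b : Fin n → Bool, (∑ p, M p * (signVal (b p.1) * signVal (b p.2))) ^ 2 =
      2 ^ n * ∑ p, (M p ^ 2 + M p * M p.swap) := by
  have hterm : ∀ p q : Fin n × Fin n,
      ∑ b : Fin n → Bool, (M p * (signVal (b p.1) * signVal (b p.2))) *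
        (M q * (signVal (b q.1) * signVal (b q.2))) =
      2 ^ n * ((if q = p then M p * M q else 0) + if q = p.swap then M p * M q else 0) := by
    intro p q
    by_cases hp : p.1 = p.2
    · have : M p = 0 := by
        obtain ⟨i, j⟩ := p
        obtain rfl : i = j := hp
        exact hM i
      simp [this]
    by_cases hq : q.1 = q.2
    · have : M q = 0 := by
        obtain ⟨i, j⟩ := q
        obtain rfl : i = j := hq
        exact hM i
      simp [this]
    calc _ = M p * M q * ∑ b : Fin n → Bool,
          (signVal (b p.1) * signVal (b p.2)) * (signVal (b q.1) * signVal (b q.2)) := by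
          rw [Finset.mul_sum]
          exact Finset.sum_congr rfl fun b _ => by ring
      _ = _ := by
          rw [sum_signVal_pairs hp hq]
          split_ifs <;> ring
  simp_rw [sq (∑ p, _), Finset.sum_mul_sum]
  rw [Finset.sum_comm]
  simp_rw [Finset.sum_comm (s := (Finset.univ : Finset (Fin n → Bool))), hterm,
    ← Finset.mul_sum, Finset.sum_add_distrib]
  simp [sq]

theorem sum_sq_sign_chaos_le {n : ℕ} (M : Fin n × Fin n → ℝ) (hM : ∀ i, M (i, i) = 0) :
    ∑ b : Fin n → Bool, (∑ p, M p * (signVal (b p.1) * signVal (b p.2))) ^ 2 ≤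
      2 ^ n * (2 * ∑ p, M p ^ 2) := by
  rw [sum_sq_sign_chaos M hM]
  gcongr
  have hswap : ∑ p : Fin n × Fin n, M p.swap ^ 2 = ∑ p, M p ^ 2 :=
    Equiv.sum_comp (Equiv.prodComm (Fin n) (Fin n)) fun p => M p ^ 2
  calc ∑ p, (M p ^ 2 + M p * M p.swap) ≤ ∑ p, (3 / 2 * M p ^ 2 + 1 / 2 * M p.swap ^ 2) :=
        Finset.sum_le_sum fun p _ => by nlinarith [sq_nonneg (M p - M p.swap)]
    _ = 2 * ∑ p, M p ^ 2 := by
        rw [Finset.sum_add_distrib, ← Finset.mul_sum, ← Finset.mul_sum, hswap]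
        ring

/-- Two distinct indices collide under a uniform hash function with probability `1 / t`: shifting
the value `h i` by a constant permutes the hash functions, and exactly one of the `t` shifts leads
to a collision. -/
theorem mul_sum_collision {n t : ℕ} {i j : Fin n} (hij : i ≠ j) :
    (t : ℝ) * ∑ h : Fin n → Fin t, (if h i = h j then 1 else 0) = (t : ℝ) ^ n := by
  rcases t.eq_zero_or_pos with rfl | ht
  · simp [i.pos.ne']
  have : NeZero t := ⟨ht.ne'⟩
  have hshift : ∀ a : Fin t, ∑ h : Fin n → Fin t, (if h i = h j then (1 : ℝ) else 0) =
      ∑ h : Fin n → Fin t, if a = h j - h i then 1 else 0 := by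
    intro a
    rw [← Equiv.sum_comp (Equiv.addRight (Pi.single i a : Fin n → Fin t))]
    refine Finset.sum_congr rfl fun h _ => ?_
    simp [hij.symm, eq_sub_iff_add_eq, add_comm]
  calc (t : ℝ) * ∑ h : Fin n → Fin t, (if h i = h j then (1 : ℝ) else 0)
      = ∑ _a : Fin t, ∑ h : Fin n → Fin t, (if h i = h j then (1 : ℝ) else 0) := by simp
    _ = ∑ a : Fin t, ∑ h : Fin n → Fin t, if a = h j - h i then (1 : ℝ) else 0 :=
        Finset.sum_congr rfl fun a _ => hshift a
    _ = (t : ℝ) ^ n := by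
        rw [Finset.sum_comm]
        simp

/-! ### The deviation of the sketched Gram matrix from the identity -/

/-- The coefficient of the product of the signs `p.1` and `p.2` in the entry `(k, l)` of
`Uᵀ Sᵀ S U - 1`: only distinct indices in the same bucket contribute. -/
def collisionWeight {n r t : ℕ} (U : Matrix (Fin n) (Fin r) ℝ) (h : Fin n → Fin t) (k l : Fin r)
    (p : Fin n × Fin n) : ℝ :=
  if p.1 ≠ p.2 ∧ h p.1 = h p.2 then U p.1 k * U p.2 l else 0

/-- The entry `(k, l)` of `Uᵀ Sᵀ S U - 1`, where `S` is the sparse embedding matrix of `h` and `b`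
and `U` has orthonormal columns. -/
def gramDeviation {n r t : ℕ} (U : Matrix (Fin n) (Fin r) ℝ) (h : Fin n → Fin t)
    (b : Fin n → Bool) (k l : Fin r) : ℝ :=
  ∑ p, collisionWeight U h k l p * (signVal (b p.1) * signVal (b p.2))

theorem sum_sq_eq_one {n r : ℕ} {U : Matrix (Fin n) (Fin r) ℝ} (hU : Uᵀ * U = 1) (k : Fin r) :
    ∑ i, U i k ^ 2 = 1 := by
  have := congrFun (congrFun hU k) k
  simpa [Matrix.mul_apply, sq] using this

/-- Each entry of the deviation has second moment at most `2 / t`; the `t ^ n * 2 ^ n` equally likely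
outcomes are kept as a factor. -/
theorem mul_sum_gramDeviation_sq_le {n r t : ℕ} {U : Matrix (Fin n) (Fin r) ℝ} (hU : Uᵀ * U = 1)
    (k l : Fin r) :
    (t : ℝ) * ∑ h : Fin n → Fin t, ∑ b, gramDeviation U h b k l ^ 2 ≤
      2 * ((t : ℝ) ^ n * 2 ^ n) := by
  have hsq : ∀ p : Fin n × Fin n,
      (t : ℝ) * ∑ h : Fin n → Fin t, collisionWeight U h k l p ^ 2 ≤
        (t : ℝ) ^ n * (U p.1 k ^ 2 * U p.2 l ^ 2) := by
    rintro ⟨i, j⟩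
    by_cases hij : i = j
    · simp only [collisionWeight, hij, ne_eq, not_true, false_and, if_false]
      simp only [zero_pow two_ne_zero, Finset.sum_const_zero, mul_zero]
      positivity
    · rw [← mul_sum_collision (t := t) hij, mul_assoc, Finset.sum_mul]
      refine le_of_eq (congrArg _ (Finset.sum_congr rfl fun h _ => ?_))
      simp only [collisionWeight, ne_eq, hij, not_false_eq_true, true_and]
      split_ifs <;> ring
  have hone : ∑ p : Fin n × Fin n, U p.1 k ^ 2 * U p.2 l ^ 2 = 1 := by
    rw [Fintype.sum_prod_type' (f := fun i j => U i k ^ 2 * U j l ^ 2), ← Finset.sum_mul_sum,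
      sum_sq_eq_one hU, sum_sq_eq_one hU, one_mul]
  calc (t : ℝ) * ∑ h : Fin n → Fin t, ∑ b, gramDeviation U h b k l ^ 2
      ≤ (t : ℝ) * ∑ h : Fin n → Fin t, 2 ^ n * (2 * ∑ p, collisionWeight U h k l p ^ 2) := by
        gcongr with h
        exact sum_sq_sign_chaos_le _ fun i => by simp [collisionWeight]
    _ = 2 * 2 ^ n * ∑ p, (t : ℝ) * ∑ h : Fin n → Fin t, collisionWeight U h k l p ^ 2 := by
        rw [← Finset.mul_sum, ← Finset.mul_sum, ← Finset.mul_sum, Finset.sum_comm]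
        ring
    _ ≤ 2 * 2 ^ n * ∑ p : Fin n × Fin n, (t : ℝ) ^ n * (U p.1 k ^ 2 * U p.2 l ^ 2) := by
        exact mul_le_mul_of_nonneg_left (Finset.sum_le_sum fun p _ => hsq p) (by positivity)
    _ = 2 * ((t : ℝ) ^ n * 2 ^ n) := by
        rw [← Finset.mul_sum, hone]
        ring

theorem l2norm_sq {n : ℕ} (y : Fin n → ℝ) : l2norm y ^ 2 = ∑ i, y i ^ 2 := by
  simp [l2norm, EuclideanSpace.norm_sq_eq]

theorem l2norm_nonneg {n : ℕ} (y : Fin n → ℝ) : 0 ≤ l2norm y := norm_nonneg _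

theorem sparseEmbedding_mulVec {n t : ℕ} (h : Fin n → Fin t) (b : Fin n → Bool) (y : Fin n → ℝ)
    (a : Fin t) :
    (sparseEmbedding h b *ᵥ y) a = ∑ i, if h i = a then signVal (b i) * y i else 0 := by
  simp [sparseEmbedding, signMatrix, hashMatrix, Matrix.mulVec, dotProduct, Matrix.mul_diagonal]

/-- For a vector of the form `U x`, the sketch changes the squared norm by the quadratic form of the
deviation at `x`. Orthonormality of the columns is not needed here: the diagonal terms
`(σ i * y i) ^ 2` add up to the squared norm of `y = U x`. -/
theorem l2norm_sparseEmbedding_mulVec_sq {n r t : ℕ} {U : Matrix (Fin n) (Fin r) ℝ}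
    (h : Fin n → Fin t) (b : Fin n → Bool) (x : Fin r → ℝ) :
    l2norm (sparseEmbedding h b *ᵥ (U *ᵥ x)) ^ 2 =
      l2norm (U *ᵥ x) ^ 2 + ∑ k, ∑ l, gramDeviation U h b k l * (x k * x l) := by
  set y := U *ᵥ x with hy
  have hyi : ∀ i, y i = ∑ k, U i k * x k := fun i => rfl
  have hquad : ∑ k, ∑ l, gramDeviation U h b k l * (x k * x l) =
      ∑ i, ∑ j, (if i ≠ j ∧ h i = h j then (signVal (b i) * y i) * (signVal (b j) * y j)
        else 0) := by
    rw [← Fintype.sum_prod_type' (f := fun i j => if i ≠ j ∧ h i = h j then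
      (signVal (b i) * y i) * (signVal (b j) * y j) else 0)]
    simp_rw [gramDeviation, Finset.sum_mul]
    simp_rw [Finset.sum_comm (t := (Finset.univ : Finset (Fin n × Fin n)))]
    refine Finset.sum_congr rfl fun p _ => ?_
    by_cases hp : p.1 ≠ p.2 ∧ h p.1 = h p.2
    · simp only [collisionWeight, if_pos hp, hyi]
      calc _ = signVal (b p.1) * signVal (b p.2) *
            ((∑ k, U p.1 k * x k) * ∑ l, U p.2 l * x l) := by
            rw [Finset.sum_mul_sum, Finset.mul_sum]
            refine Finset.sum_congr rfl fun k _ => ?_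
            rw [Finset.mul_sum]
            exact Finset.sum_congr rfl fun l _ => by ring
        _ = _ := by ring
    · simp [collisionWeight, if_neg hp]
  have hdiag : ∑ i, y i ^ 2 = ∑ i, ∑ j, (if i = j then
      (signVal (b i) * y i) * (signVal (b j) * y j) else 0) := by
    refine Finset.sum_congr rfl fun i _ => ?_
    rw [Finset.sum_ite_eq, if_pos (Finset.mem_univ i), mul_mul_mul_comm, signVal_mul_self, one_mul,
      sq]
  rw [l2norm_sq, l2norm_sq, hquad, hdiag, ← Finset.sum_add_distrib]
  simp_rw [sparseEmbedding_mulVec, sq, Finset.sum_mul_sum]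
  rw [Finset.sum_comm]
  refine Finset.sum_congr rfl fun i _ => ?_
  rw [Finset.sum_comm, ← Finset.sum_add_distrib]
  refine Finset.sum_congr rfl fun j _ => ?_
  by_cases hij : i = j
  · subst hij
    simp
  · by_cases hh : h i = h j
    · simp [hij, hh]
    · simp only [hij, hh, ite_mul, zero_mul, if_false, and_false, add_zero]
      rw [Finset.sum_ite_eq]
      simp [Ne.symm hh]

theorem l2norm_mulVec_of_orthonormal {n r : ℕ} {U : Matrix (Fin n) (Fin r) ℝ} (hU : Uᵀ * U = 1)
    (x : Fin r → ℝ) : l2norm (U *ᵥ x) ^ 2 = ∑ k, x k ^ 2 := by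
  have h : (U *ᵥ x) ⬝ᵥ (U *ᵥ x) = x ⬝ᵥ x := by
    rw [Matrix.dotProduct_mulVec, Matrix.vecMul_mulVec, hU, Matrix.vecMul_one]
  rw [l2norm_sq]
  simpa [dotProduct, sq] using h

/-! ### The probability of a subspace embedding -/

/-- A deviation of Frobenius norm at most `ε` gives a subspace embedding, by the Cauchy–Schwarz
inequality `|xᵀ G x| ≤ ‖G‖_F * ‖x‖²`. -/
theorem isSubspaceEmbedding_of_gramDeviation {n d r t : ℕ} {ε : ℝ} (hε : 0 < ε) (hε1 : ε < 1)
    {A : Matrix (Fin n) (Fin d) ℝ} {U : Matrix (Fin n) (Fin r) ℝ}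
    (hU : IsOrthonormalBasisOf U A) (h : Fin n → Fin t) (b : Fin n → Bool)
    (hG : ∑ k, ∑ l, gramDeviation U h b k l ^ 2 ≤ ε ^ 2) :
    IsSubspaceEmbedding ε (sparseEmbedding h b) A := by
  intro y hy
  rw [← hU.2] at hy
  obtain ⟨x, rfl⟩ := hy
  rw [Matrix.mulVecLin_apply]
  set N := l2norm (U *ᵥ x) with hN
  have hN0 : 0 ≤ N := l2norm_nonneg _
  have hNsq : N ^ 2 = ∑ k, x k ^ 2 := l2norm_mulVec_of_orthonormal hU.1 x
  have hid := l2norm_sparseEmbedding_mulVec_sq (U := U) h b x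
  rw [← hN] at hid
  set Q := ∑ k, ∑ l, gramDeviation U h b k l * (x k * x l) with hQ
  have hQsq : Q ^ 2 ≤ (ε * N ^ 2) ^ 2 := by
    have hcs := Finset.sum_mul_sq_le_sq_mul_sq Finset.univ
      (fun p : Fin r × Fin r => gramDeviation U h b p.1 p.2) fun p => x p.1 * x p.2
    simp only [Fintype.sum_prod_type, mul_pow] at hcs
    rw [← Finset.sum_mul_sum, ← hNsq] at hcs
    calc Q ^ 2 ≤ _ := hcs
      _ ≤ ε ^ 2 * (N ^ 2 * N ^ 2) := by gcongr
      _ = _ := by ring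
  -- From `(1 - ε) N² ≤ N² + Q ≤ (1 + ε) N²` the bounds on norms follow, as `(1 - ε)² ≤ 1 - ε` and
  -- `1 + ε ≤ (1 + ε)²`.
  have hQabs := abs_le_of_sq_le_sq' hQsq (by positivity)
  have hS0 := l2norm_nonneg (sparseEmbedding h b *ᵥ (U *ᵥ x))
  constructor
  · refine le_of_sq_le_sq ?_ hS0
    rw [hid]
    nlinarith [mul_nonneg (mul_nonneg hε.le (sub_nonneg.2 hε1.le)) (sq_nonneg N)]
  · refine le_of_sq_le_sq ?_ (by positivity)
    rw [hid]
    nlinarith [mul_nonneg (mul_nonneg hε.le hε.le) (sq_nonneg N), mul_nonneg hε.le (sq_nonneg N)]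

/-- Markov's inequality for the squared Frobenius norm of the deviation: `20 (r / ε)²` rows leave a
failure probability of at most `1 / 10`. -/
theorem embeddingProb_ge {n d r t : ℕ} {ε : ℝ} (hε : 0 < ε) (hε1 : ε < 1)
    {A : Matrix (Fin n) (Fin d) ℝ} {U : Matrix (Fin n) (Fin r) ℝ}
    (hU : IsOrthonormalBasisOf U A) (ht : 0 < t) (htr : 20 * ((r : ℝ) / ε) ^ 2 ≤ t) :
    9 / 10 ≤ embeddingProb t ε A := by
  classical
  have : NeZero t := ⟨ht.ne'⟩
  set F : (Fin n → Fin t) × (Fin n → Bool) → ℝ :=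
    fun ω => ∑ k, ∑ l, gramDeviation U ω.1 ω.2 k l ^ 2 with hF
  set good := Finset.univ.filter fun ω : (Fin n → Fin t) × (Fin n → Bool) =>
    IsSubspaceEmbedding ε (sparseEmbedding ω.1 ω.2) A with hgood
  set K : ℝ := (t : ℝ) ^ n * 2 ^ n with hK
  have ht0 : (0 : ℝ) < t := by exact_mod_cast ht
  have hK0 : 0 < K := by positivity
  have hcard : (Fintype.card ((Fin n → Fin t) × (Fin n → Bool)) : ℝ) = K := by simp [hK]
  have hprob : embeddingProb t ε A = (good.card : ℝ) / K := by
    have hset : {ω : (Fin n → Fin t) × (Fin n → Bool) |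
        IsSubspaceEmbedding ε (sparseEmbedding ω.1 ω.2) A} = (good : Set _) := by
      ext ω
      simp [hgood]
    rw [embeddingProb, sketchMeasure, hset, MeasureTheory.measureReal_def,
      ProbabilityTheory.uniformOn_univ, MeasureTheory.Measure.count_apply_finset,
      ENNReal.toReal_div, ENNReal.toReal_natCast, ENNReal.toReal_natCast, hcard]
  have hmoment : (t : ℝ) * ∑ ω, F ω ≤ 2 * r ^ 2 * K := by
    have hswap : ∑ ω, F ω = ∑ k, ∑ l, ∑ h : Fin n → Fin t, ∑ b, gramDeviation U h b k l ^ 2 := by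
      simp_rw [hF, ← Fintype.sum_prod_type' (f := fun (h : Fin n → Fin t) b =>
        gramDeviation U h b _ _ ^ 2)]
      rw [Finset.sum_comm]
      exact Finset.sum_congr rfl fun k _ => Finset.sum_comm
    rw [hswap, Finset.mul_sum]
    simp_rw [Finset.mul_sum (s := (Finset.univ : Finset (Fin r)))]
    calc _ ≤ ∑ _k : Fin r, ∑ _l : Fin r, 2 * K :=
          Finset.sum_le_sum fun k _ => Finset.sum_le_sum fun l _ =>
            mul_sum_gramDeviation_sq_le hU.1 k l
      _ = 2 * r ^ 2 * K := by
          simp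
          ring
  have hmarkov : ε ^ 2 * (K - good.card) ≤ ∑ ω, F ω := by
    have hF0 : ∀ ω, 0 ≤ F ω := fun ω =>
      Finset.sum_nonneg fun k _ => Finset.sum_nonneg fun l _ => sq_nonneg _
    have hcompl : K - good.card = (goodᶜ.card : ℝ) := by
      rw [Finset.card_compl, Nat.cast_sub (Finset.card_le_univ _), hcard]
    rw [hcompl]
    calc ε ^ 2 * (goodᶜ.card : ℝ) = ∑ _ω ∈ goodᶜ, ε ^ 2 := by
          simp [mul_comm]
      _ ≤ ∑ ω ∈ goodᶜ, F ω := by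
          refine Finset.sum_le_sum fun ω hω => ?_
          by_contra hlt
          simp only [hgood, Finset.mem_compl, Finset.mem_filter, Finset.mem_univ, true_and] at hω
          exact hω (isSubspaceEmbedding_of_gramDeviation hε hε1 hU _ _ (not_le.1 hlt).le)
      _ ≤ ∑ ω, F ω := Finset.sum_le_univ_sum_of_nonneg hF0
  rw [hprob, le_div_iff₀ hK0]
  have hr : 20 * (r : ℝ) ^ 2 ≤ t * ε ^ 2 := by
    rw [div_pow, mul_div_assoc', div_le_iff₀ (by positivity)] at htr
    exact htr
  have h1 : t * (ε ^ 2 * (K - good.card)) ≤ 2 * r ^ 2 * K :=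
    (mul_le_mul_of_nonneg_left hmarkov ht0.le).trans hmoment
  have h2 : t * ε ^ 2 * (K - good.card) ≤ t * ε ^ 2 * (K / 10) := by nlinarith
  have h3 := le_of_mul_le_mul_left h2 (by positivity)
  linarith

theorem exists_isOrthonormalBasisOf {n d : ℕ} (A : Matrix (Fin n) (Fin d) ℝ) :
    ∃ U : Matrix (Fin n) (Fin A.rank) ℝ, IsOrthonormalBasisOf U A := by
  let e := WithLp.linearEquiv 2 ℝ (Fin n → ℝ)
  let V : Submodule ℝ (EuclideanSpace ℝ (Fin n)) := (colSpace A).comap e.toLinearMap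
  have hV : Module.finrank ℝ V = A.rank := by
    have : V = (colSpace A).map e.symm.toLinearMap := Submodule.comap_equiv_eq_map_symm e _
    rw [this, LinearEquiv.finrank_map_eq]
    rfl
  let B := (stdOrthonormalBasis ℝ V).reindex (finCongr hV)
  refine ⟨Matrix.of fun i k => (B k : EuclideanSpace ℝ (Fin n)) i, ?_, ?_⟩
  · ext k l
    have := orthonormal_iff_ite.1 B.orthonormal k l
    rw [Submodule.coe_inner, PiLp.inner_apply] at this
    simpa [Matrix.mul_apply, Matrix.one_apply, mul_comm] using this
  · have hspan := B.toBasis.span_eq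
    rw [colSpace, Matrix.range_mulVecLin]
    have hcols : Set.range (Matrix.of fun (i : Fin n) k => (B k : EuclideanSpace ℝ (Fin n)) i).col =
        e '' (V.subtype '' Set.range B) := by
      rw [← Set.range_comp, ← Set.range_comp]
      rfl
    rw [hcols, ← LinearEquiv.coe_coe, ← Submodule.map_span, ← Submodule.map_span,
      ← OrthonormalBasis.coe_toBasis, hspan, Submodule.map_top, Submodule.range_subtype]
    exact Submodule.map_comap_eq_of_surjective e.surjective _

/-! ### A linear time program -/

/-- The program that draws and applies a sparse embedding matrix. After the constant `1` is put into
word register `5`, the instructions `1` to `6` draw the hash values into word array `2` and the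
signs into real array `2`, with the index in word register `4`. The instructions `7` to `19` process
the listed entries, with the position in the list in word register `7`: an entry in row `i` and
column `j` is multiplied by the sign of `i` and added to cell `h i * d + j` of real array `1`. Both
loops test their condition at the end, which is right since there is at least one row and at least
one entry. -/
def sketchProgram : List Instr :=
  [.wconst 5 1,
   .drawIndex 6, .wstore 2 4 6, .drawSign 0, .rstore 2 4 0, .wadd 4 4 5, .jumpLt 4 0 1,
   .wload 8 0 7, .wload 9 2 8, .wmul 9 9 1, .wload 10 1 7, .wadd 9 9 10, .rload 0 2 8,
   .rload 1 0 7, .rmul 0 0 1, .rload 1 1 9, .radd 0 0 1, .rstore 1 9 0, .wadd 7 7 5,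
   .jumpLt 7 3 7]

theorem machineRun_add {t : ℕ} (prog : List Instr) (W : ℕ) (hs : ℕ → Fin t) (bs : ℕ → Bool)
    (k l : ℕ) (c : Config) :
    machineRun prog W hs bs (k + l) c =
      machineRun prog W hs bs l (machineRun prog W hs bs k c) := by
  rw [add_comm]
  exact Function.iterate_add_apply _ l k c

/-- The part of the input that the program reads in its second loop is intact. -/
structure Config.HasInput {n d : ℕ} (c : Config) (A : Matrix (Fin n) (Fin d) ℝ)
    (e : EntryList A) : Prop where
  cols : c.wreg 1 = d
  entries : c.wreg 3 = nnz A
  rowIdx : ∀ k : Fin (nnz A), c.wmem 0 k = (e k).1.1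
  colIdx : ∀ k : Fin (nnz A), c.wmem 1 k = (e k).1.2
  values : ∀ k : Fin (nnz A), c.rmem 0 k = A (e k).1.1 (e k).1.2

/-- The first `m` hash values and signs are stored in word array `2` and real array `2`. -/
structure Config.HasSketch {t : ℕ} (c : Config) (hs : ℕ → Fin t) (bs : ℕ → Bool) (m : ℕ) :
    Prop where
  hash : ∀ i < m, c.wmem 2 i = hs i
  sign : ∀ i < m, c.rmem 2 i = signVal (bs i)

/-- The invariant of the first loop after `m` rounds; the program counter is at the start of the
loop, or behind the loop when all `n` rounds are done. -/
structure DrawInvariant {n d t : ℕ} (A : Matrix (Fin n) (Fin d) ℝ) (e : EntryList A)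
    (hs : ℕ → Fin t) (bs : ℕ → Bool) (m : ℕ) (c : Config) : Prop extends
    c.HasInput A e, c.HasSketch hs bs m where
  pc : c.pc = if m < n then 1 else 7
  rows : c.wreg 0 = n
  counter : c.wreg 4 = m
  one : c.wreg 5 = 1
  entryCounter : c.wreg 7 = 0
  out : ∀ x, c.rmem 1 x = 0
  indexPos : c.indexPos = m
  signPos : c.signPos = m

theorem DrawInvariant.step {n d t W m : ℕ} {A : Matrix (Fin n) (Fin d) ℝ} {e : EntryList A}
    {hs : ℕ → Fin t} {bs : ℕ → Bool} {c : Config} (hW : n < W) (hm : m < n)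
    (hc : DrawInvariant A e hs bs m c) :
    DrawInvariant A e hs bs (m + 1) (machineRun sketchProgram W hs bs 6 c) := by
  obtain ⟨pc, wreg, rreg, wmem, rmem, ip, sp⟩ := c
  obtain ⟨⟨h1, h3, hr, hcl, hv⟩, ⟨hh, hsg⟩, hpc, h0, h4, h5, h7, ho, hip, hsp⟩ := hc
  rw [if_pos hm] at hpc
  dsimp only at *
  subst hpc hip hsp
  have hmod : (sp + 1) % W = sp + 1 := Nat.mod_eq_of_lt (by omega)
  simp only [machineRun, Function.iterate_succ, Function.iterate_zero, Function.comp_apply, id,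
    machineStep, sketchProgram, Instr.exec, storeCell, List.getElem?_cons_succ,
    List.getElem?_cons_zero, Nat.reduceAdd]
  refine ⟨⟨?_, ?_, ?_, ?_, ?_⟩, ⟨?_, ?_⟩, ?_, ?_, ?_, ?_, ?_, ?_, ?_, ?_⟩ <;>
    simp [h0, h1, h3, h4, h5, h7, hr, hcl, hv, ho, hmod]
  · intro i hi
    rcases hi.lt_or_eq with hi | rfl
    · simp [hi.ne, hh i hi]
    · simp
  · intro i hi
    rcases hi.lt_or_eq with hi | rfl
    · simp [hi.ne, hsg i hi]
    · simp

/-- The contribution of the entry of `A` at position `p` to the entry `(a, b)` of `Φ D A`. -/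
def entryTerm {n d t : ℕ} (A : Matrix (Fin n) (Fin d) ℝ) (hs : ℕ → Fin t) (bs : ℕ → Bool)
    (p : Fin n × Fin d) (a : Fin t) (b : Fin d) : ℝ :=
  if hs p.1 = a ∧ p.2 = b then signVal (bs p.1) * A p.1 p.2 else 0

/-- The invariant of the second loop after `m` rounds: the output array holds the contributions of
the first `m` listed entries. -/
structure AccumulateInvariant {n d t : ℕ} (A : Matrix (Fin n) (Fin d) ℝ) (e : EntryList A)
    (hs : ℕ → Fin t) (bs : ℕ → Bool) (m : ℕ) (c : Config) : Prop extends
    c.HasInput A e, c.HasSketch hs bs n where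
  pc : c.pc = if m < nnz A then 7 else 20
  one : c.wreg 5 = 1
  counter : c.wreg 7 = m
  out : ∀ (a : Fin t) (b : Fin d), c.rmem 1 ((a : ℕ) * d + b) =
    ∑ k : Fin (nnz A), if (k : ℕ) < m then entryTerm A hs bs (e k).1 a b else 0

theorem sum_if_le {N m : ℕ} (hm : m < N) (f : Fin N → ℝ) :
    (∑ k : Fin N, if (k : ℕ) ≤ m then f k else 0) =
      (∑ k : Fin N, if (k : ℕ) < m then f k else 0) + f ⟨m, hm⟩ := by
  have hsplit : ∀ k : Fin N, (if (k : ℕ) ≤ m then f k else 0) =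
      (if (k : ℕ) < m then f k else 0) + if k = ⟨m, hm⟩ then f k else 0 := by
    intro k
    rcases lt_trichotomy (k : ℕ) m with h | h | h
    · simp [h, Fin.ext_iff, h.ne, h.le]
    · simp [Fin.ext_iff, h]
    · simp [Fin.ext_iff, h.ne', not_lt.2 h.le, Nat.not_le.2 h]
  rw [Finset.sum_congr rfl fun k _ => hsplit k, Finset.sum_add_distrib]
  simp

theorem mul_add_inj_of_lt {d a a' : ℕ} {b b' : Fin d} :
    a * d + (b : ℕ) = a' * d + (b' : ℕ) ↔ a = a' ∧ b = b' := by
  refine ⟨fun h => ?_, by rintro ⟨rfl, rfl⟩; rfl⟩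
  have hdiv : ∀ (x : ℕ) (y : Fin d), (x * d + (y : ℕ)) / d = x := fun x y => by
    rw [mul_comm, Nat.mul_add_div y.pos, Nat.div_eq_of_lt y.2, add_zero]
  have ha : a = a' := by rw [← hdiv a b, h, hdiv]
  subst ha
  exact ⟨rfl, Fin.ext (Nat.add_left_cancel h)⟩

theorem mul_add_lt_of_lt {d t : ℕ} (a : Fin t) (b : Fin d) : (a : ℕ) * d + b < t * d :=
  calc (a : ℕ) * d + b < (a + 1) * d := by rw [add_one_mul]; omega
    _ ≤ t * d := Nat.mul_le_mul_right d a.2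

theorem AccumulateInvariant.step {n d t W m : ℕ} {A : Matrix (Fin n) (Fin d) ℝ} {e : EntryList A}
    {hs : ℕ → Fin t} {bs : ℕ → Bool} {c : Config} (hW : nnz A < W) (hW' : t * d < W)
    (hm : m < nnz A) (hc : AccumulateInvariant A e hs bs m c) :
    AccumulateInvariant A e hs bs (m + 1) (machineRun sketchProgram W hs bs 13 c) := by
  obtain ⟨pc, wreg, rreg, wmem, rmem, ip, sp⟩ := c
  obtain ⟨⟨h1, h3, hr, hcl, hv⟩, ⟨hh, hsg⟩, hpc, h5, h7, ho⟩ := hc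
  rw [if_pos hm] at hpc
  dsimp only at *
  subst hpc
  set p := (e ⟨m, hm⟩).1 with hp
  have hrm : wmem 0 m = p.1 := hr ⟨m, hm⟩
  have hcm : wmem 1 m = p.2 := hcl ⟨m, hm⟩
  have hvm : rmem 0 m = A p.1 p.2 := hv ⟨m, hm⟩
  have hhm : wmem 2 p.1 = hs p.1 := hh _ p.1.2
  have hsm : rmem 2 p.1 = signVal (bs p.1) := hsg _ p.1.2
  have hlt := (mul_add_lt_of_lt (hs p.1) p.2).trans hW'
  have hmod : (m + 1) % W = m + 1 := Nat.mod_eq_of_lt (by omega)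
  -- The address of an output cell is a word, so it is computed without wrapping around.
  have haddr : (hs p.1 * d + p.2 : ℕ) % W = hs p.1 * d + p.2 := Nat.mod_eq_of_lt hlt
  have hrun : machineRun sketchProgram W hs bs 13 ⟨7, wreg, rreg, wmem, rmem, ip, sp⟩ =
      { pc := if m + 1 < nnz A then 7 else 20
        wreg := Function.update (Function.update (Function.update (Function.update
          (Function.update wreg 8 p.1) 9 ((hs p.1 * d : ℕ) % W)) 10 p.2) 9 (hs p.1 * d + p.2))
          7 (m + 1)
        rreg := Function.update (Function.update (Function.update (Function.update
          (Function.update rreg 0 (signVal (bs p.1))) 1 (A p.1 p.2))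
          0 (signVal (bs p.1) * A p.1 p.2)) 1 (rmem 1 (hs p.1 * d + p.2)))
          0 (signVal (bs p.1) * A p.1 p.2 + rmem 1 (hs p.1 * d + p.2))
        wmem := wmem
        rmem := storeCell rmem 1 (hs p.1 * d + p.2)
          (signVal (bs p.1) * A p.1 p.2 + rmem 1 (hs p.1 * d + p.2))
        indexPos := ip
        signPos := sp } := by
    simp [machineRun, machineStep, sketchProgram, Instr.exec, storeCell, h1, h3, h5, h7, hrm, hcm,
      hvm, hhm, hsm, haddr, hmod]
  rw [hrun]
  refine ⟨⟨?_, ?_, ?_, ?_, ?_⟩, ⟨?_, ?_⟩, ?_, ?_, ?_, ?_⟩ <;>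
    simp +contextual [storeCell, h1, h3, h5, hr, hcl, hv, hh, hsg]
  intro a b
  rw [sum_if_le hm, ← ho, ← hp, entryTerm]
  by_cases hab : hs p.1 = a ∧ p.2 = b
  · obtain ⟨rfl, rfl⟩ := hab
    simp [add_comm]
  · have hne : (a : ℕ) * d + b ≠ hs p.1 * d + p.2 := by
      rw [Ne, mul_add_inj_of_lt]
      rintro ⟨ha, hb⟩
      exact hab ⟨Fin.ext ha.symm, hb.symm⟩
    simp [hne, hab]

/-- Each entry of `Φ D A` is the sum of the contributions of the listed entries of `A`, because the
unlisted entries are zero. -/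
theorem sparseEmbedding_mul_apply_eq_sum {n d t : ℕ} (A : Matrix (Fin n) (Fin d) ℝ)
    (e : EntryList A) (hs : ℕ → Fin t) (bs : ℕ → Bool) (a : Fin t) (b : Fin d) :
    (sparseEmbedding (fun i : Fin n => hs i) (fun i : Fin n => bs i) * A) a b =
      ∑ k, entryTerm A hs bs (e k).1 a b := by
  classical
  have hsub : ∑ k, entryTerm A hs bs (e k).1 a b = ∑ p, entryTerm A hs bs p a b := by
    rw [Equiv.sum_comp e fun q => entryTerm A hs bs q.1 a b,
      ← Finset.sum_subtype (Finset.univ.filter fun p : Fin n × Fin d => A p.1 p.2 ≠ 0)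
        (by simp) fun p => entryTerm A hs bs p a b]
    refine Finset.sum_filter_of_ne fun p _ hp hA => hp ?_
    simp [entryTerm, hA]
  rw [hsub, Fintype.sum_prod_type]
  change (sparseEmbedding _ _ *ᵥ fun i => A i b) a = _
  rw [sparseEmbedding_mulVec]
  simp [entryTerm, ite_and]

/-- An invariant of a loop whose body takes `L` steps holds after `N` rounds. -/
theorem machineRun_loop {t : ℕ} {prog : List Instr} {W : ℕ} {hs : ℕ → Fin t} {bs : ℕ → Bool}
    {P : ℕ → Config → Prop} {N L : ℕ}
    (hstep : ∀ m c, m < N → P m c → P (m + 1) (machineRun prog W hs bs L c)) {c : Config}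
    (hc : P 0 c) : P N (machineRun prog W hs bs (N * L) c) := by
  suffices ∀ m ≤ N, P m (machineRun prog W hs bs (m * L) c) from this N le_rfl
  intro m
  induction m with
  | zero => intro _; simpa [machineRun] using hc
  | succ m ih =>
    intro hm
    rw [add_one_mul, machineRun_add]
    exact hstep m _ hm (ih (by omega))

theorem sketchesWithin_sketchProgram {n d t : ℕ} (A : Matrix (Fin n) (Fin d) ℝ) (hn : 0 < n)
    (hnnz : n ≤ nnz A) : SketchesWithin sketchProgram A t (20 * nnz A) := by
  intro e W hW1 hW2 hW3 hs bs
  have hinit : DrawInvariant A e hs bs 0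
      (machineRun sketchProgram W hs bs 1 (initialConfig A e t)) := by
    have hone : 1 % W = 1 := Nat.mod_eq_of_lt (by omega)
    simp only [machineRun, Function.iterate_succ, Function.iterate_zero, Function.comp_apply, id,
      machineStep, sketchProgram, Instr.exec, initialConfig, List.getElem?_cons_zero]
    refine ⟨⟨?_, ?_, ?_, ?_, ?_⟩, ⟨?_, ?_⟩, ?_, ?_, ?_, ?_, ?_, ?_, ?_, ?_⟩ <;> simp [hone, hn]
  have hdraw := machineRun_loop (fun m c hm hc => DrawInvariant.step hW1 hm hc) hinit
  rw [← machineRun_add] at hdraw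
  have hstart : AccumulateInvariant A e hs bs 0
      (machineRun sketchProgram W hs bs (1 + n * 6) (initialConfig A e t)) :=
    { hdraw.toHasInput, hdraw.toHasSketch with
      pc := by simp [hdraw.pc, hn.trans_le hnnz]
      one := hdraw.one
      counter := hdraw.entryCounter
      out := by simp [hdraw.out] }
  have hfinal := machineRun_loop (fun m c hm hc => AccumulateInvariant.step hW2 hW3 hm hc) hstart
  rw [← machineRun_add] at hfinal
  refine ⟨1 + n * 6 + nnz A * 13, ?_, ?_, ?_⟩
  · omega
  · rw [Config.Halted, hfinal.pc, if_neg (lt_irrefl _)]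
    rfl
  · intro a b
    rw [hfinal.out, sparseEmbedding_mul_apply_eq_sum A e]
    simp

/-! ### Both bounds on the number of rows, and the running time -/

theorem half_le_log {x : ℝ} (hx : 2 ≤ x) : 1 / 2 ≤ Real.log x :=
  calc (1 / 2 : ℝ) ≤ Real.log 2 := by linarith [Real.log_two_gt_d9]
    _ ≤ Real.log x := Real.log_le_log two_pos hx

theorem theorem1 :
    -- a suitable number of rows, which depends on `r` and `ε` only
    (∃ C : ℝ, 0 < C ∧ ∀ (r : ℕ) (ε : ℝ), 0 < ε → ε < 1 → 2 ≤ (r : ℝ) / ε →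
      ∃ t : ℕ, (t : ℝ) ≤ C * (((r : ℝ) / ε) ^ 4 * Real.log ((r : ℝ) / ε) ^ 2) ∧
        ∀ (n d : ℕ) (A : Matrix (Fin n) (Fin d) ℝ), A.rank = r →
          9 / 10 ≤ embeddingProb t ε A) ∧
    -- one program computes `Φ D A` in time linear in the number of non-zero entries
    (∃ (prog : List Instr) (C : ℕ), ∀ (n d t : ℕ) (A : Matrix (Fin n) (Fin d) ℝ),
      0 < n → n ≤ nnz A → 0 < t → SketchesWithin prog A t (C * nnz A)) ∧
    -- the sufficient condition on the number of rows through leverage scores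
    (∃ c : ℝ, 0 < c ∧ ∀ (r : ℕ) (ε T : ℝ), 0 < ε → ε < 1 → 2 ≤ (r : ℝ) / ε →
      0 < T → T ≤ c * (ε ^ 2 / ((r : ℝ) * Real.log ((r : ℝ) / ε))) →
        ∀ (n d t : ℕ) (A : Matrix (Fin n) (Fin d) ℝ) (U : Matrix (Fin n) (Fin r) ℝ),
          A.rank = r → IsOrthonormalBasisOf U A →
          max ((thresholdIndex U T : ℝ) ^ 2 / 30) ((r : ℝ) / T) ≤ (t : ℝ) →
            9 / 10 ≤ embeddingProb t ε A) := by
  refine ⟨⟨21, by norm_num, ?_⟩, ⟨sketchProgram, 20, ?_⟩, ⟨1 / 40, by norm_num, ?_⟩⟩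
  · intro r ε hε hε1 hr
    have hlog := half_le_log hr
    set x := (r : ℝ) / ε with hx
    refine ⟨⌈20 * x ^ 2⌉₊, ?_, ?_⟩
    · have hceil := (Nat.ceil_lt_add_one (show 0 ≤ 20 * x ^ 2 by positivity)).le
      have hxx : 4 ≤ x ^ 2 := by nlinarith
      have hone : 1 ≤ x ^ 2 * Real.log x ^ 2 := by
        have : 1 ≤ x * Real.log x := by nlinarith
        rw [← mul_pow]
        exact one_le_pow₀ this
      calc _ ≤ _ := hceil
        _ ≤ 21 * (x ^ 2 * 1) := by linarith
        _ ≤ 21 * (x ^ 2 * (x ^ 2 * Real.log x ^ 2)) := by gcongr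
        _ = _ := by ring
    · rintro n d A rfl
      obtain ⟨U, hU⟩ := exists_isOrthonormalBasisOf A
      have hpos : 0 < 20 * x ^ 2 := by positivity
      exact embeddingProb_ge hε hε1 hU (Nat.ceil_pos.2 hpos) (Nat.le_ceil _)
  · intro n d t A hn hnnz _
    exact sketchesWithin_sketchProgram A hn hnnz
  · intro r ε T hε hε1 hr hT hTle n d t A U _ hU hmax
    have hlog := half_le_log hr
    have hr0 : (0 : ℝ) < r := by
      by_contra h
      have := div_nonpos_of_nonpos_of_nonneg (not_lt.1 h) hε.le
      linarith
    have hTr : 20 * ((r : ℝ) / ε) ^ 2 ≤ r / T := by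
      have hT' : T ≤ ε ^ 2 / (20 * r) := by
        refine hTle.trans ?_
        rw [div_mul_div_comm, one_mul]
        refine div_le_div₀ (sq_nonneg ε) le_rfl (by positivity) ?_
        nlinarith
      rw [le_div_iff₀ hT]
      calc 20 * ((r : ℝ) / ε) ^ 2 * T ≤ 20 * ((r : ℝ) / ε) ^ 2 * (ε ^ 2 / (20 * r)) := by gcongr
        _ = (r : ℝ) := by field_simp
    have htT : (r : ℝ) / T ≤ t := (le_max_right _ _).trans hmax
    have ht : (0 : ℝ) < t := (div_pos hr0 hT).trans_le htT
    exact embeddingProb_ge hε hε1 hU (by exact_mod_cast ht) (hTr.trans htT)
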